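/- Let $A$ and $\Omega$ be Polish spaces, $\mu$ a Borel probability measure on $\Omega$, $\lambda>0$, and let $u:A\times\Omega\to(-\infty,\overline u]$ be measurable, with $\overline u\in\mathbb R$. For probability measures $\nu\in\Delta A$ and $P\in\Delta(A\times\Omega)$ with marginals $P_\alpha,P_\omega$, put $$Z(\omega;\nu)=\int e^{u(\alpha,\omega)/\lambda}\,d\nu(\alpha),\qquad f(\nu)=\int\log Z(\omega;\nu)\,d\mu(\omega)\in[-\infty,\infty),$$ $$V(\nu)=\sup_{P\in\Pi(\nu,\mu)}\Big\{\int \tfrac{u}{\lambda}\,dP-D_{KL}(P\,\|\,\nu\otimes\mu)\Big\},\qquad J(P)=\int \tfrac{u}{\lambda}\,dP-D_{KL}(P\,\|\,P_\alpha\otimes P_\omega),$$ where $\Pi(\nu,\mu)$ is the set of couplings of $\nu$ and $\mu$. A Schrödinger bridge between $\nu$ and $\mu$ is a $P\in\Pi(\nu,\mu)$ attaining the supremum $V(\nu)$; Schrödinger potentials for $\nu$ are functions $a\in L^1(\nu)$, $b\in L^1(\mu)$ such that a Schrödinger bridge $P$ satisfies $P\ll\nu\otimes\mu$ and $\frac{dP}{d(\nu\otimes\mu)}(\alpha,\omega)=e^{u(\alpha,\omega)/\lambda-a(\alpha)-b(\omega)}$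 almost everywhere. An optimal information policy is a $P\in\Delta(A\times\Omega)$ which maximizes $J$ among all probability measures on $A\times\Omega$ with $P_\omega=\mu$. 1. Let $\nu,\psi\in\Delta A$ and $\nu_\varepsilon=(1-\varepsilon)\nu+\varepsilon\psi$, and suppose that for all small $\varepsilon>0$ the numbers $f(\nu_\varepsilon)$ and $f(\nu)$ are not both $-\infty$ (which holds, for instance, if $f(\nu)>-\infty$). Then the Gateaux derivative of $f$ at $\nu$ in the direction of $\psi$ exists in $(-\infty,+\infty]$ and equals $$\partial_\psi f(\nu):=\lim_{\varepsilon\downarrow0}\frac{f(\nu_\varepsilon)-f(\nu)}{\varepsilon}=\int\left(\frac{\int e^{u(\alpha,\omega)/\lambda}\,d\psi(\alpha)}{\int e^{u(\alpha,\omega)/\lambda}\,d\nu(\alpha)}-1\right)d\mu(\omega),$$ where both sides may be $+\infty$. 2. Let $P$ be an optimal information policy and $\nu=P_\alpha$. Then $V(\nu)=f(\nu)=\int\log Z(\omega;\nu)\,d\mu(\omega)$, and for $\nu$-a.e. $\alpha$ the function $\omega\mapsto e^{u(\alpha,\omega)/\lambda}/Z(\omega;\nu)$ is in $L^1(\mu)$.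 If moreover $J(P)>-\infty$, then $P$ is a Schrödinger bridge between $\nu$ and $\mu$ with Schrödinger potentials $a_\nu(\alpha)=0$ and $b_\nu(\omega)=\log Z(\omega;\nu)$; these are the only Schrödinger potentials for $\nu$ up to null sets and the translations $(a,b)\mapsto(a+c,b-c)$, $c\in\mathbb R$; and $f(\nu)=\int b_\nu\,d\mu$ is finite. -/

import Mathlib

open MeasureTheory Filter Topology

noncomputable section

namespace RationalInattention

/-- The integral `∫ g dm ∈ [-∞, +∞]` of a real function: the integral of the positive part minus the
integral of the negative part. It is the standard extended integral as soon as one of the two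
is finite. -/
def extIntegral {X : Type*} [MeasurableSpace X] (m : Measure X) (g : X → ℝ) : EReal :=
  ((∫⁻ x, ENNReal.ofReal (g x) ∂m : ENNReal) : EReal)
    - ((∫⁻ x, ENNReal.ofReal (-g x) ∂m : ENNReal) : EReal)

variable {A Ω : Type*} [MeasurableSpace A] [MeasurableSpace Ω]

/-- The partition function `Z(ω; ν) = ∫ exp (u(α, ω) / lam) dν(α)`. -/
def partition (u : A × Ω → ℝ) (lam : ℝ) (ν : Measure A) (ω : Ω) : ℝ :=
  ∫ α, Real.exp (u (α, ω) / lam) ∂ν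

/-- The Jensen envelope `f(ν) = ∫ log Z(ω; ν) dμ(ω)`, with values in `[-∞, +∞]`. -/
def envelope (u : A × Ω → ℝ) (lam : ℝ) (μ : Measure Ω) (ν : Measure A) : EReal :=
  extIntegral μ (fun ω => Real.log (partition u lam ν ω))

/-- The mixture `(1 - ε) ν + ε ψ`. -/
def mixture (ν ψ : Measure A) (ε : ℝ) : Measure A :=
  ENNReal.ofReal (1 - ε) • ν + ENNReal.ofReal ε • ψ

/-- `F` has Gateaux derivative `d ∈ [-∞, +∞]` at `ν` in the direction of `ψ`:
`(F((1 - ε) ν + ε ψ) - F(ν)) / ε → d` as `ε ↓ 0`. -/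
def HasGateauxDeriv (F : Measure A → EReal) (ν ψ : Measure A) (d : EReal) : Prop :=
  Tendsto (fun ε : ℝ => (F (mixture ν ψ ε) - F ν) / (ε : EReal)) (𝓝[>] 0) (𝓝 d)

/-- `Π(ν, μ)`: the probability measures on `A × Ω` with marginals `ν` and `μ`. -/
def couplings (ν : Measure A) (μ : Measure Ω) : Set (Measure (A × Ω)) :=
  {P | IsProbabilityMeasure P ∧ P.fst = ν ∧ P.snd = μ}

/-- `∫ u / lam dP - D_KL(P ‖ ν ⊗ μ)`. -/
def bridgePayoff (u : A × Ω → ℝ) (lam : ℝ) (ν : Measure A) (μ : Measure Ω)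
    (P : Measure (A × Ω)) : EReal :=
  extIntegral P (fun x => u x / lam) - (InformationTheory.klDiv P (ν.prod μ) : EReal)

/-- `V(ν)`, the value of the Schrödinger bridge problem between `ν` and `μ`. -/
def bridgeValue (u : A × Ω → ℝ) (lam : ℝ) (μ : Measure Ω) (ν : Measure A) : EReal :=
  ⨆ P ∈ couplings ν μ, bridgePayoff u lam ν μ P

/-- `P` is a Schrödinger bridge between `ν` and `μ`. -/
def IsSchrodingerBridge (u : A × Ω → ℝ) (lam : ℝ) (ν : Measure A) (μ : Measure Ω)
    (P : Measure (A × Ω)) : Prop :=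
  P ∈ couplings ν μ ∧ bridgePayoff u lam ν μ P = bridgeValue u lam μ ν

/-- `a ∈ L¹(ν)`, `b ∈ L¹(μ)` are Schrödinger potentials of the Schrödinger bridge `P` between `ν`
and `μ`: `dP / d(ν ⊗ μ) = exp (u / lam - a - b)`. -/
def IsSchrodingerPotentials (u : A × Ω → ℝ) (lam : ℝ) (ν : Measure A) (μ : Measure Ω)
    (P : Measure (A × Ω)) (a : A → ℝ) (b : Ω → ℝ) : Prop :=
  IsSchrodingerBridge u lam ν μ P ∧ Integrable a ν ∧ Integrable b μ ∧
    P ≪ ν.prod μ ∧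
    P.rnDeriv (ν.prod μ) =ᵐ[ν.prod μ]
      fun x => ENNReal.ofReal (Real.exp (u x / lam - a x.1 - b x.2))

/-- The payoff `∫ u / lam dP - D_KL(P ‖ P_α ⊗ P_ω)` of an information policy `P`. -/
def policyPayoff (u : A × Ω → ℝ) (lam : ℝ) (P : Measure (A × Ω)) : EReal :=
  extIntegral P (fun x => u x / lam) - (InformationTheory.klDiv P (P.fst.prod P.snd) : EReal)

/-- `P` is an optimal information policy: among all probability measures on `A × Ω` with second
marginal `μ`, it maximizes the payoff. -/
def IsOptimalPolicy (u : A × Ω → ℝ) (lam : ℝ) (μ : Measure Ω) (P : Measure (A × Ω)) : Prop :=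
  (IsProbabilityMeasure P ∧ P.snd = μ) ∧
    ∀ Q : Measure (A × Ω), IsProbabilityMeasure Q → Q.snd = μ →
      policyPayoff u lam Q ≤ policyPayoff u lam P

end RationalInattention

end

/-! Derivative: `log Z(ω; ν_ε) - log Z(ω; ν) = log (1 + ε D(ω))`, where `D = Z(·; ψ) / Z(·; ν) - 1 ≥
-1`. The quotients `log (1 + ε D) / ε` tend to `D`, are at most `D`, and are at least `-2` once `ε ≤
1/2`. Fatou's lemma from below and domination by `D` from above give the limit of their integrals,
finite or not.

Optimal policies: let `G` be the Gibbs policy, with density `exp (u / lam) / Z` with respect to `ν ⊗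
μ`. A coupling `P` of finite payoff earns `f(ν) - D_KL(P ‖ G)`. Hence `V(ν) ≤ f(ν)`, and only `G`
can attain a finite `f(ν)`. The second marginal of `G` is `μ`, but the first may differ from `ν`; by
the chain rule, using its own marginal as reference only lowers the divergence, so `f(ν) ≤ J(G)`. If
`P` is optimal and `ν = P_α`, then `V(ν) ≤ f(ν) ≤ J(G) ≤ J(P) ≤ V(ν)`. All are equal, and if they
are finite then `P = G`, whose density displays the potentials. -/

namespace RationalInattention

/-! ### Extended integrals of functions bounded on one side -/

section ExtIntegral

variable {X : Type*} [MeasurableSpace X] {m : Measure X} {g : X → ℝ}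

theorem extIntegral_of_integrable (hg : Integrable g m) :
    extIntegral m g = ((∫ x, g x ∂m : ℝ) : EReal) := by
  have h1 : ∫⁻ x, ENNReal.ofReal (g x) ∂m ≠ ⊤ := hg.lintegral_lt_top.ne
  have h2 : ∫⁻ x, ENNReal.ofReal (-g x) ∂m ≠ ⊤ := hg.neg.lintegral_lt_top.ne
  rw [extIntegral, integral_eq_lintegral_pos_part_sub_lintegral_neg_part hg, EReal.coe_sub,
    EReal.coe_ennreal_toReal h1, EReal.coe_ennreal_toReal h2]

theorem integrable_of_lintegral_ofReal (hg : AEStronglyMeasurable g m)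
    (h1 : ∫⁻ x, ENNReal.ofReal (g x) ∂m ≠ ⊤) (h2 : ∫⁻ x, ENNReal.ofReal (-g x) ∂m ≠ ⊤) :
    Integrable g m := by
  refine ⟨hg, ?_⟩
  have h : ∫⁻ x, ‖g x‖ₑ ∂m
      ≤ ∫⁻ x, (ENNReal.ofReal (g x) + ENNReal.ofReal (-g x)) ∂m := by
    refine lintegral_mono fun x => ?_
    rw [Real.enorm_eq_ofReal_abs]
    rcases abs_cases (g x) with ⟨h, _⟩ | ⟨h, _⟩ <;> rw [h] <;> simp
  refine h.trans_lt ?_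
  rw [lintegral_add_left' hg.aemeasurable.ennreal_ofReal]
  exact ENNReal.add_lt_top.2 ⟨h1.lt_top, h2.lt_top⟩

theorem lintegral_ofReal_ne_top_of_le [IsFiniteMeasure m] {C : ℝ} (h : ∀ x, g x ≤ C) :
    ∫⁻ x, ENNReal.ofReal (g x) ∂m ≠ ⊤ := by
  refine ((lintegral_mono (g := fun _ => ENNReal.ofReal C)
    fun x => ENNReal.ofReal_le_ofReal (h x)).trans_lt ?_).ne
  simpa using ENNReal.mul_lt_top ENNReal.ofReal_lt_top (measure_lt_top m _)

theorem extIntegral_eq_bot_or_integrable [IsFiniteMeasure m] (hg : AEStronglyMeasurable g m)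
    {C : ℝ} (h : ∀ x, g x ≤ C) : extIntegral m g = ⊥ ∨ Integrable g m := by
  have h1 := lintegral_ofReal_ne_top_of_le (m := m) h
  by_cases h2 : ∫⁻ x, ENNReal.ofReal (-g x) ∂m = ⊤
  · left
    rw [extIntegral, h2, EReal.coe_ennreal_top, EReal.sub_top]
  · exact Or.inr (integrable_of_lintegral_ofReal hg h1 h2)

theorem extIntegral_eq_bot_iff [IsFiniteMeasure m] (hg : AEStronglyMeasurable g m)
    {C : ℝ} (h : ∀ x, g x ≤ C) : extIntegral m g = ⊥ ↔ ¬ Integrable g m := by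
  refine ⟨fun h1 h2 => ?_, fun h1 => (extIntegral_eq_bot_or_integrable hg h).resolve_right h1⟩
  rw [extIntegral_of_integrable h2] at h1
  exact EReal.coe_ne_bot _ h1

theorem extIntegral_eq_top [IsFiniteMeasure m] (hg : AEStronglyMeasurable g m)
    {c : ℝ} (h : ∀ x, -c ≤ g x) (hi : ¬ Integrable g m) : extIntegral m g = ⊤ := by
  have h2 : ∫⁻ x, ENNReal.ofReal (-g x) ∂m ≠ ⊤ :=
    lintegral_ofReal_ne_top_of_le (C := c) fun x => by linarith [h x]
  have h1 : ∫⁻ x, ENNReal.ofReal (g x) ∂m = ⊤ := by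
    by_contra h1
    exact hi (integrable_of_lintegral_ofReal hg h1 h2)
  rw [extIntegral, h1, EReal.coe_ennreal_top, EReal.top_sub]
  simpa using h2

/-- Shifting a function bounded below makes it nonnegative, so that limits can be taken in `ENNReal`
even when the integral is infinite. -/
theorem extIntegral_eq_lintegral_sub [IsProbabilityMeasure m] (hg : Measurable g)
    {c : ℝ} (h : ∀ x, -c ≤ g x) :
    extIntegral m g = ((∫⁻ x, ENNReal.ofReal (g x + c) ∂m : ENNReal) : EReal) - (c : EReal) := by
  by_cases hi : Integrable g m
  · have hi' : Integrable (fun x => g x + c) m := hi.add (integrable_const c)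
    have h0 : 0 ≤ᵐ[m] fun x => g x + c := ae_of_all _ fun x => by
      have := h x; simp only [Pi.zero_apply]; linarith
    rw [extIntegral_of_integrable hi, ← ofReal_integral_eq_lintegral_ofReal hi' h0,
      EReal.coe_ennreal_ofReal, max_eq_left (integral_nonneg_of_ae h0), ← EReal.coe_sub,
      integral_add hi (integrable_const c)]
    simp
  · have h3 : ∫⁻ x, ENNReal.ofReal (g x + c) ∂m = ⊤ := by
      by_contra h3
      refine hi ?_
      have : Integrable (fun x => g x + c) m :=
        integrable_of_lintegral_ofReal (hg.add_const c).aestronglyMeasurable h3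
          (lintegral_ofReal_ne_top_of_le (C := 0) fun x => by linarith [h x])
      exact (this.sub (integrable_const c)).congr (ae_of_all _ fun x => by simp)
    rw [extIntegral_eq_top hg.aestronglyMeasurable h hi, h3, EReal.coe_ennreal_top,
      EReal.top_sub_coe]

end ExtIntegral

/-- Fatou's lemma bounds the limit from below and `F i ≤ G` bounds it from above. Unlike dominated
convergence, this allows `∫⁻ G = ⊤`. -/
theorem tendsto_lintegral_of_le {X ι : Type*} [MeasurableSpace X] {m : Measure X} {l : Filter ι}
    [l.IsCountablyGenerated] [l.NeBot] {F : ι → X → ENNReal} {G : X → ENNReal}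
    (hF : ∀ i, Measurable (F i)) (hle : ∀ᶠ i in l, ∀ x, F i x ≤ G x)
    (hlim : ∀ x, Tendsto (fun i => F i x) l (𝓝 (G x))) :
    Tendsto (fun i => ∫⁻ x, F i x ∂m) l (𝓝 (∫⁻ x, G x ∂m)) := by
  refine tendsto_of_le_liminf_of_limsup_le ?_ ?_
  · calc ∫⁻ x, G x ∂m = ∫⁻ x, liminf (fun i => F i x) l ∂m :=
          lintegral_congr fun x => (hlim x).liminf_eq.symm
      _ ≤ _ := lintegral_liminf_le hF
  · exact limsup_le_of_le (h := hle.mono fun i hi => lintegral_mono hi)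

theorem exp_div_le {X : Type*} {u : X → ℝ} {lam ubar : ℝ} (hubar : ∀ x, u x ≤ ubar)
    (hlam : 0 < lam) (x : X) :
    Real.exp (u x / lam) ≤ Real.exp (ubar / lam) :=
  Real.exp_le_exp.2 (div_le_div_of_nonneg_right (hubar x) hlam.le)

/-! ### The partition function and its behaviour under mixtures -/

section Partition

variable {A Ω : Type*} [MeasurableSpace A] [MeasurableSpace Ω] {u : A × Ω → ℝ} {lam ubar : ℝ}

theorem integrable_exp_div (hu : Measurable u) (hubar : ∀ x, u x ≤ ubar) (hlam : 0 < lam)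
    (ν : Measure A) [IsFiniteMeasure ν] (ω : Ω) :
    Integrable (fun α => Real.exp (u (α, ω) / lam)) ν := by
  refine Integrable.of_bound (C := Real.exp (ubar / lam))
    (Measurable.aestronglyMeasurable (by fun_prop)) (ae_of_all _ fun α => ?_)
  rw [Real.norm_of_nonneg (Real.exp_nonneg _)]
  exact exp_div_le hubar hlam _

theorem measurable_partition (hu : Measurable u) (lam : ℝ) (ν : Measure A) [SFinite ν] :
    Measurable (partition u lam ν) := by
  unfold partition
  refine StronglyMeasurable.measurable ?_
  refine StronglyMeasurable.integral_prod_left' (f := fun x : A × Ω => Real.exp (u x / lam)) ?_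
  exact Measurable.stronglyMeasurable (by fun_prop)

theorem partition_pos (hu : Measurable u) (hubar : ∀ x, u x ≤ ubar) (hlam : 0 < lam)
    (ν : Measure A) [IsProbabilityMeasure ν] (ω : Ω) : 0 < partition u lam ν ω :=
  integral_exp_pos (integrable_exp_div hu hubar hlam ν ω)

theorem log_partition_le (hu : Measurable u) (hubar : ∀ x, u x ≤ ubar) (hlam : 0 < lam)
    (ν : Measure A) [IsProbabilityMeasure ν] (ω : Ω) :
    Real.log (partition u lam ν ω) ≤ ubar / lam := by
  rw [Real.log_le_iff_le_exp (partition_pos hu hubar hlam ν ω)]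
  calc partition u lam ν ω ≤ ∫ _, Real.exp (ubar / lam) ∂ν :=
        integral_mono (integrable_exp_div hu hubar hlam ν ω) (integrable_const _)
          fun α => exp_div_le hubar hlam _
    _ = _ := by simp

theorem envelope_eq_bot_iff (hu : Measurable u) (hubar : ∀ x, u x ≤ ubar) (hlam : 0 < lam)
    (μ : Measure Ω) [IsProbabilityMeasure μ] (ν : Measure A) [IsProbabilityMeasure ν] :
    envelope u lam μ ν = ⊥ ↔ ¬ Integrable (fun ω => Real.log (partition u lam ν ω)) μ :=
  extIntegral_eq_bot_iff (measurable_partition hu lam ν).log.aestronglyMeasurable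
    (log_partition_le hu hubar hlam ν)

theorem isProbabilityMeasure_mixture (ν ψ : Measure A) [IsProbabilityMeasure ν]
    [IsProbabilityMeasure ψ] {ε : ℝ} (h0 : 0 ≤ ε) (h1 : ε ≤ 1) :
    IsProbabilityMeasure (mixture ν ψ ε) := by
  constructor
  simp only [mixture, Measure.coe_add, Measure.coe_smul, Pi.add_apply, Pi.smul_apply, measure_univ,
    smul_eq_mul, mul_one]
  rw [← ENNReal.ofReal_add (by linarith) h0]
  simp

theorem partition_mixture (hu : Measurable u) (hubar : ∀ x, u x ≤ ubar) (hlam : 0 < lam)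
    (ν ψ : Measure A) [IsProbabilityMeasure ν] [IsProbabilityMeasure ψ] {ε : ℝ} (h0 : 0 ≤ ε)
    (h1 : ε ≤ 1) (ω : Ω) :
    partition u lam (mixture ν ψ ε) ω
      = (1 - ε) * partition u lam ν ω + ε * partition u lam ψ ω := by
  unfold partition mixture
  rw [integral_add_measure, integral_smul_measure, integral_smul_measure,
    ENNReal.toReal_ofReal (by linarith), ENNReal.toReal_ofReal h0]
  · simp
  · exact (integrable_exp_div hu hubar hlam ν ω).smul_measure ENNReal.ofReal_ne_top
  · exact (integrable_exp_div hu hubar hlam ψ ω).smul_measure ENNReal.ofReal_ne_top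

/-- The identity `Z(ω; ν_ε) = Z(ω; ν) (1 + ε (Z(ω; ψ) / Z(ω; ν) - 1))` in logarithmic form. -/
theorem log_partition_mixture (hu : Measurable u) (hubar : ∀ x, u x ≤ ubar) (hlam : 0 < lam)
    (ν ψ : Measure A) [IsProbabilityMeasure ν] [IsProbabilityMeasure ψ] {ε : ℝ} (h0 : 0 ≤ ε)
    (h1 : ε < 1) (ω : Ω) :
    Real.log (partition u lam (mixture ν ψ ε) ω) = Real.log (partition u lam ν ω)
      + Real.log (1 + ε * (partition u lam ψ ω / partition u lam ν ω - 1)) := by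
  have hν := partition_pos hu hubar hlam ν ω
  have hr := div_pos (partition_pos hu hubar hlam ψ ω) hν
  have h2 : 0 < 1 + ε * (partition u lam ψ ω / partition u lam ν ω - 1) := by
    nlinarith [mul_nonneg h0 hr.le]
  rw [partition_mixture hu hubar hlam ν ψ h0 h1.le, ← Real.log_mul hν.ne' h2.ne']
  congr 1
  field_simp
  ring

end Partition
end RationalInattention

/-! ### The Gateaux derivative of the Jensen envelope -/

namespace RationalInattention

/-- The bound does not depend on `D`: `log (1 - ε) ≥ -ε / (1 - ε) ≥ -2 ε`. It makes the difference
quotients bounded below by `-2` uniformly in `ω`. -/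
theorem neg_two_mul_le_log_one_add {ε D : ℝ} (h0 : 0 ≤ ε) (h1 : ε ≤ 1 / 2) (hD : -1 ≤ D) :
    -(2 * ε) ≤ Real.log (1 + ε * D) := by
  have h2 : 1 - ε ≤ 1 + ε * D := by nlinarith
  calc -(2 * ε) ≤ 1 - (1 - ε)⁻¹ := by
        have : (1 - ε)⁻¹ ≤ 1 + 2 * ε := by
          rw [inv_le_iff_one_le_mul₀ (by linarith)]
          nlinarith
        linarith
    _ ≤ Real.log (1 - ε) := Real.one_sub_inv_le_log_of_pos (by linarith)
    _ ≤ _ := Real.log_le_log (by linarith) h2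

theorem log_one_add_le {ε D : ℝ} (h0 : 0 ≤ ε) (h1 : ε ≤ 1 / 2) (hD : -1 ≤ D) :
    Real.log (1 + ε * D) ≤ ε * D := by
  have := Real.log_le_sub_one_of_pos (x := 1 + ε * D) (by nlinarith)
  linarith

theorem tendsto_log_one_add_div (D : ℝ) :
    Tendsto (fun ε : ℝ => Real.log (1 + ε * D) / ε) (𝓝[>] 0) (𝓝 D) := by
  have h : HasDerivAt (fun ε : ℝ => Real.log (1 + ε * D)) D 0 := by
    have h1 : HasDerivAt (fun ε : ℝ => 1 + ε * D) D 0 := by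
      simpa using ((hasDerivAt_id (0 : ℝ)).mul_const D).const_add 1
    simpa using h1.log (by simp)
  have h2 := (hasDerivAt_iff_tendsto_slope_zero.1 h).mono_left
    (nhdsWithin_mono (0 : ℝ) (s := Set.Ioi 0) fun x hx => ne_of_gt hx)
  refine h2.congr fun ε => ?_
  simp [div_eq_inv_mul]

variable {A Ω : Type*} [MeasurableSpace A] [MeasurableSpace Ω] {u : A × Ω → ℝ} {lam ubar : ℝ}

/-- The Gateaux derivative of the Jensen envelope. -/
theorem hasGateauxDeriv_envelope (hu : Measurable u) (hubar : ∀ x, u x ≤ ubar) (hlam : 0 < lam)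
    (μ : Measure Ω) [IsProbabilityMeasure μ] (ν ψ : Measure A) [IsProbabilityMeasure ν]
    [IsProbabilityMeasure ψ]
    (hne : ∀ᶠ ε : ℝ in 𝓝[>] 0,
      ¬ (envelope u lam μ (mixture ν ψ ε) = ⊥ ∧ envelope u lam μ ν = ⊥)) :
    HasGateauxDeriv (envelope u lam μ) ν ψ
      (extIntegral μ fun ω => partition u lam ψ ω / partition u lam ν ω - 1) := by
  set D : Ω → ℝ := fun ω => partition u lam ψ ω / partition u lam ν ω - 1 with hDdef
  have hDm : Measurable D :=
    ((measurable_partition hu lam ψ).div (measurable_partition hu lam ν)).sub_const 1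
  have hD : ∀ ω, -1 ≤ D ω := fun ω => by
    have := div_pos (partition_pos hu hubar hlam ψ ω) (partition_pos hu hubar hlam ν ω)
    simp only [hDdef]; linarith
  have hsmall : ∀ᶠ ε : ℝ in 𝓝[>] 0, 0 < ε ∧ ε ≤ 1 / 2 := by
    filter_upwards [Ioc_mem_nhdsGT (show (0 : ℝ) < 1 / 2 by norm_num)] with ε hε using hε
  have hGm (ε : ℝ) : Measurable fun ω => Real.log (1 + ε * D ω) :=
    ((hDm.const_mul ε).const_add 1).log
  by_cases hν : Integrable (fun ω => Real.log (partition u lam ν ω)) μ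
  -- Finite `f(ν)`: `log Z(·; ν_ε)` lies between `log Z(·; ν) - 2 ε` and `ubar / lam`, so the
  -- quotient is a genuine integral, shifted by 2 to be nonnegative.
  · have hquot : ∀ᶠ ε : ℝ in 𝓝[>] 0,
        ((∫⁻ ω, ENNReal.ofReal (Real.log (1 + ε * D ω) / ε + 2) ∂μ : ENNReal) : EReal)
            - ((2 : ℝ) : EReal)
          = (envelope u lam μ (mixture ν ψ ε) - envelope u lam μ ν) / (ε : EReal) := by
      filter_upwards [hsmall] with ε ⟨h0, h1⟩
      have hlog := log_partition_mixture hu hubar hlam ν ψ h0.le (by linarith : ε < 1)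
      have := isProbabilityMeasure_mixture ν ψ h0.le (by linarith : ε ≤ 1)
      have hmix : Integrable (fun ω => Real.log (partition u lam (mixture ν ψ ε) ω)) μ := by
        refine integrable_of_le_of_le
          (measurable_partition hu lam (mixture ν ψ ε)).log.aestronglyMeasurable
          (g₁ := fun ω => Real.log (partition u lam ν ω) + -(2 * ε)) (g₂ := fun _ => ubar / lam)
          (ae_of_all _ fun ω => ?_)
          (ae_of_all _ fun ω => log_partition_le hu hubar hlam (mixture ν ψ ε) ω)
          (hν.add (integrable_const _)) (integrable_const _)
        simp only [hlog]
        exact add_le_add_right (neg_two_mul_le_log_one_add h0.le h1 (hD ω)) _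
      have hG : Integrable (fun ω => Real.log (1 + ε * D ω)) μ :=
        (hmix.sub hν).congr (ae_of_all _ fun ω => by
          simp only [Pi.sub_apply, hlog]; ring)
      rw [← extIntegral_eq_lintegral_sub ((hGm ε).div_const ε),
        extIntegral_of_integrable (hG.div_const ε), envelope, envelope,
        extIntegral_of_integrable hmix, extIntegral_of_integrable hν, ← EReal.coe_sub,
        ← integral_sub hmix hν, ← EReal.coe_div, integral_div]
      · congr 3
        funext ω
        rw [hlog]; ring
      · intro ω
        rw [le_div_iff₀ h0]
        linarith [neg_two_mul_le_log_one_add h0.le h1 (hD ω)]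
    refine Tendsto.congr' hquot ?_
    rw [extIntegral_eq_lintegral_sub (c := 2) hDm fun ω => by linarith [hD ω]]
    have hlim : Tendsto
        (fun ε : ℝ => ∫⁻ ω, ENNReal.ofReal (Real.log (1 + ε * D ω) / ε + 2) ∂μ) (𝓝[>] 0)
        (𝓝 (∫⁻ ω, ENNReal.ofReal (D ω + 2) ∂μ)) := by
      refine tendsto_lintegral_of_le
        (fun ε => (((hGm ε).div_const ε).add_const 2).ennreal_ofReal) ?_ fun ω => ?_
      · filter_upwards [hsmall] with ε ⟨h0, h1⟩ ω
        refine ENNReal.ofReal_le_ofReal (add_le_add_left ?_ 2)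
        rw [div_le_iff₀ h0]
        exact (log_one_add_le h0.le h1 (hD ω)).trans_eq (mul_comm _ _)
      · exact ENNReal.tendsto_ofReal ((tendsto_log_one_add_div (D ω)).add_const 2)
    have hlim' := (continuous_coe_ennreal_ereal.tendsto _).comp hlim
    -- Addition on `EReal` is continuous here because the second summand, `-2`, is finite.
    simp only [sub_eq_add_neg, ← EReal.coe_neg]
    exact (EReal.continuousAt_add (Or.inr (EReal.coe_ne_bot _))
      (Or.inr (EReal.coe_ne_top _))).tendsto.comp (hlim'.prodMk_nhds tendsto_const_nhds)
  -- When `f(ν) = -∞`, the quotients are eventually `+∞`, so the integral of `D` must be shown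
  -- infinite.
  · have hbot := (envelope_eq_bot_iff hu hubar hlam μ ν).2 hν
    have hmix : ∀ᶠ ε : ℝ in 𝓝[>] 0, (0 < ε ∧ ε ≤ 1 / 2) ∧
        envelope u lam μ (mixture ν ψ ε) ≠ ⊥ := by
      filter_upwards [hsmall, hne] with ε h1 h2 using ⟨h1, fun h => h2 ⟨h, hbot⟩⟩
    -- Were `D` integrable, so would be `log (1 + ε D)`, squeezed between `-2 ε` and `ε D`; then
    -- `log Z(·; ν)` would be a difference of integrable functions.
    have hDi : ¬ Integrable D μ := fun hDi => by
      obtain ⟨ε, ⟨h0, h1⟩, h2⟩ := hmix.exists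
      have := isProbabilityMeasure_mixture ν ψ h0.le (by linarith : ε ≤ 1)
      rw [Ne, envelope_eq_bot_iff hu hubar hlam, not_not] at h2
      have hlog := log_partition_mixture hu hubar hlam ν ψ h0.le (by linarith : ε < 1)
      have hG : Integrable (fun ω => Real.log (1 + ε * D ω)) μ :=
        integrable_of_le_of_le (hGm ε).aestronglyMeasurable
          (ae_of_all _ fun ω => neg_two_mul_le_log_one_add h0.le h1 (hD ω))
          (ae_of_all _ fun ω => log_one_add_le h0.le h1 (hD ω))
          (integrable_const _) (hDi.const_mul ε)
      refine hν ((h2.sub hG).congr (ae_of_all _ fun ω => ?_))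
      simp only [Pi.sub_apply, hlog]; ring
    rw [extIntegral_eq_top hDm.aestronglyMeasurable hD hDi]
    refine tendsto_const_nhds.congr' ?_
    filter_upwards [hmix] with ε ⟨⟨h0, _⟩, h2⟩
    rw [hbot, EReal.sub_bot h2, EReal.top_div_of_pos_ne_top (by exact_mod_cast h0)
      (EReal.coe_ne_top _)]

end RationalInattention

/-! ### Relative entropy and exponential tilting -/

namespace RationalInattention
open InformationTheory

section Tilted

variable {X : Type*} [MeasurableSpace X] {P ρ : Measure X} {g : X → ℝ}

/-- Since `exp (-llr P ρ) = dρ/dP` holds `P`-a.e., the integral is that of `exp g` over the part of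
`ρ` absolutely continuous with respect to `P`. -/
theorem integrable_exp_sub_llr [IsFiniteMeasure P] [IsFiniteMeasure ρ] (hPρ : P ≪ ρ)
    (hgm : Measurable g) (hg : Integrable (fun x => Real.exp (g x)) ρ) :
    Integrable (fun x => Real.exp (g x - llr P ρ x)) P := by
  refine ⟨((hgm.sub (measurable_llr P ρ)).exp).aestronglyMeasurable, ?_⟩
  have h : ∫⁻ x, ‖Real.exp (g x - llr P ρ x)‖ₑ ∂P
      ≤ ∫⁻ x, ENNReal.ofReal (Real.exp (g x)) ∂ρ := by
    calc ∫⁻ x, ‖Real.exp (g x - llr P ρ x)‖ₑ ∂P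
        = ∫⁻ x, ρ.rnDeriv P x * ENNReal.ofReal (Real.exp (g x)) ∂P := by
          refine lintegral_congr_ae ?_
          filter_upwards [exp_neg_llr hPρ, ρ.rnDeriv_lt_top P] with x hx hx'
          rw [Real.enorm_of_nonneg (Real.exp_nonneg _), sub_eq_neg_add, Real.exp_add, hx,
            ENNReal.ofReal_mul ENNReal.toReal_nonneg, ENNReal.ofReal_toReal hx'.ne]
      _ = ∫⁻ x, ENNReal.ofReal (Real.exp (g x)) ∂(P.withDensity (ρ.rnDeriv P)) :=
          (lintegral_withDensity_eq_lintegral_mul _ (ρ.measurable_rnDeriv P)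
            hgm.exp.ennreal_ofReal).symm
      _ ≤ _ := lintegral_mono' (ρ.withDensity_rnDeriv_le P) le_rfl
  exact h.trans_lt hg.lintegral_lt_top

/-- Gibbs' identity for the divergence from a normalized tilted measure. -/
theorem toReal_klDiv_tilted [IsProbabilityMeasure P] [IsProbabilityMeasure ρ]
    (hPρ : klDiv P ρ ≠ ⊤) (hgP : Integrable g P) (hg : Integrable (fun x => Real.exp (g x)) ρ)
    (h1 : ∫ x, Real.exp (g x) ∂ρ = 1) :
    klDiv P (ρ.tilted g) ≠ ⊤ ∧
      (klDiv P (ρ.tilted g)).toReal = (klDiv P ρ).toReal - ∫ x, g x ∂P := by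
  obtain ⟨hac, hllr⟩ := klDiv_ne_top_iff.1 hPρ
  have hac' := hac.trans (absolutelyContinuous_tilted hg)
  have := isProbabilityMeasure_tilted hg
  refine ⟨klDiv_ne_top hac' (integrable_llr_tilted_right hac hgP hllr hg), ?_⟩
  rw [toReal_klDiv_of_measure_eq hac' (by simp), toReal_klDiv_of_measure_eq hac (by simp),
    integral_llr_tilted_right hac hgP hg hllr, h1, Real.log_one, add_zero]

theorem klDiv_tilted_self [IsProbabilityMeasure ρ] (hgm : Measurable g)
    (hg : Integrable (fun x => Real.exp (g x)) ρ) (h1 : ∫ x, Real.exp (g x) ∂ρ = 1)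
    (hgQ : Integrable g (ρ.tilted g)) :
    klDiv (ρ.tilted g) ρ ≠ ⊤ ∧ (klDiv (ρ.tilted g) ρ).toReal = ∫ x, g x ∂(ρ.tilted g) := by
  have hac := tilted_absolutelyContinuous ρ g
  have := isProbabilityMeasure_tilted hg
  have h : llr (ρ.tilted g) ρ =ᵐ[ρ.tilted g] g := by
    refine hac.ae_eq ?_
    filter_upwards [llr_tilted_left (Measure.AbsolutelyContinuous.refl ρ) hg hgm.aemeasurable,
      llr_self ρ] with x hx hx'
    rw [hx, hx', h1]; simp
  refine ⟨klDiv_ne_top hac ((integrable_congr h).2 hgQ), ?_⟩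
  rw [toReal_klDiv_of_measure_eq hac (by simp), integral_congr_ae h]

/-- The density of the tilt cancels `exp (-g)` up to the normalizing constant. -/
theorem integrable_exp_neg_tilted [IsProbabilityMeasure ρ]
    (hg : Integrable (fun x => Real.exp (g x)) ρ) :
    Integrable (fun x => Real.exp (-g x)) (ρ.tilted g) := by
  rw [integrable_tilted_iff hg]
  refine (integrable_const (1 : ℝ)).congr (ae_of_all _ fun x => ?_)
  simp [← Real.exp_add]

end Tilted

/-- Replacing the first factor of the reference measure by the marginal lowers the divergence. -/
theorem klDiv_fst_prod_le {A Ω : Type*} [MeasurableSpace A] [MeasurableSpace Ω]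
    [StandardBorelSpace Ω] (Q : Measure (A × Ω)) [IsProbabilityMeasure Q]
    (ν : Measure A) [IsProbabilityMeasure ν] (μ : Measure Ω) [IsProbabilityMeasure μ] :
    klDiv Q (Q.fst.prod μ) ≤ klDiv Q (ν.prod μ) := by
  have : Nonempty Ω := nonempty_of_isProbabilityMeasure μ
  -- Chain rule: `D(Q ‖ ν ⊗ μ) = D(Q.fst ‖ ν) + D(Q ‖ Q.fst ⊗ μ)`.
  have h := klDiv_compProd_eq_add (μ := Q.fst) (ν := ν) (κ := Q.condKernel)
    (η := ProbabilityTheory.Kernel.const A μ)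
  rw [Q.disintegrate Q.condKernel, Measure.compProd_const, Measure.compProd_const] at h
  rw [h]
  exact le_add_self

/-! ### The Gibbs policy and the Schrödinger bridge value -/

section Gibbs

variable {A Ω : Type*} [MeasurableSpace A] [MeasurableSpace Ω] {u : A × Ω → ℝ} {lam ubar : ℝ}

/-- The logarithm of the density of the Gibbs policy with respect to `ν ⊗ μ`. -/
noncomputable def gibbsExponent (u : A × Ω → ℝ) (lam : ℝ) (ν : Measure A) (x : A × Ω) : ℝ :=
  u x / lam - Real.log (partition u lam ν x.2)

/-- The Gibbs policy, with density `exp (u / lam) / Z` with respect to `ν ⊗ μ`. -/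
noncomputable def gibbsPolicy (u : A × Ω → ℝ) (lam : ℝ) (μ : Measure Ω) (ν : Measure A) : Measure (A × Ω) :=
  (ν.prod μ).tilted (gibbsExponent u lam ν)

theorem measurable_gibbsExponent (hu : Measurable u) (lam : ℝ) (ν : Measure A) [SFinite ν] :
    Measurable (gibbsExponent u lam ν) :=
  (hu.div_const lam).sub ((measurable_partition hu lam ν).log.comp measurable_snd)

theorem exp_gibbsExponent (hu : Measurable u) (hubar : ∀ x, u x ≤ ubar) (hlam : 0 < lam)
    (ν : Measure A) [IsProbabilityMeasure ν] (x : A × Ω) :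
    Real.exp (gibbsExponent u lam ν x) = Real.exp (u x / lam) / partition u lam ν x.2 := by
  rw [gibbsExponent, Real.exp_sub, Real.exp_log (partition_pos hu hubar hlam ν x.2)]

/-- Normalization holds separately for each `ω`, which is why the Gibbs policy has second marginal
`μ`. -/
theorem lintegral_exp_gibbsExponent_left (hu : Measurable u) (hubar : ∀ x, u x ≤ ubar)
    (hlam : 0 < lam) (ν : Measure A) [IsProbabilityMeasure ν] (ω : Ω) :
    ∫⁻ α, ENNReal.ofReal (Real.exp (gibbsExponent u lam ν (α, ω))) ∂ν = 1 := by
  simp only [exp_gibbsExponent hu hubar hlam]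
  rw [← ofReal_integral_eq_lintegral_ofReal
    ((integrable_exp_div hu hubar hlam ν ω).div_const _)
    (ae_of_all _ fun α => div_nonneg (Real.exp_nonneg _) (partition_pos hu hubar hlam ν ω).le),
    integral_div]
  change ENNReal.ofReal (partition u lam ν ω / partition u lam ν ω) = 1
  rw [div_self (partition_pos hu hubar hlam ν ω).ne', ENNReal.ofReal_one]

theorem integrable_comp_snd_iff {P : Measure (A × Ω)} {μ : Measure Ω} (hP : P.snd = μ) {h : Ω → ℝ}
    (hh : Measurable h) : Integrable (fun x => h x.2) P ↔ Integrable h μ := by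
  rw [← hP, Measure.snd, integrable_map_measure hh.aestronglyMeasurable
    measurable_snd.aemeasurable]
  rfl

theorem integral_comp_snd {P : Measure (A × Ω)} {μ : Measure Ω} (hP : P.snd = μ) {h : Ω → ℝ}
    (hh : Measurable h) : ∫ x, h x.2 ∂P = ∫ ω, h ω ∂μ := by
  rw [← hP, Measure.snd, integral_map measurable_snd.aemeasurable hh.aestronglyMeasurable]

variable {μ : Measure Ω} [IsProbabilityMeasure μ] {ν : Measure A} [IsProbabilityMeasure ν]

theorem setLIntegral_exp_gibbsExponent (hu : Measurable u) (hubar : ∀ x, u x ≤ ubar)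
    (hlam : 0 < lam) {s : Set Ω} (_ : MeasurableSet s) :
    ∫⁻ x in Prod.snd ⁻¹' s, ENNReal.ofReal (Real.exp (gibbsExponent u lam ν x)) ∂(ν.prod μ)
      = μ s := by
  have hm := (measurable_gibbsExponent hu lam ν).exp.ennreal_ofReal
  rw [← Set.univ_prod, ← Measure.prod_restrict, Measure.restrict_univ,
    lintegral_prod_symm _ hm.aemeasurable]
  simp [lintegral_exp_gibbsExponent_left hu hubar hlam]

theorem lintegral_exp_gibbsExponent (hu : Measurable u) (hubar : ∀ x, u x ≤ ubar)
    (hlam : 0 < lam) :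
    ∫⁻ x, ENNReal.ofReal (Real.exp (gibbsExponent u lam ν x)) ∂(ν.prod μ) = 1 := by
  simpa using setLIntegral_exp_gibbsExponent (μ := μ) (ν := ν) hu hubar hlam MeasurableSet.univ

theorem integrable_exp_gibbsExponent (hu : Measurable u) (hubar : ∀ x, u x ≤ ubar)
    (hlam : 0 < lam) :
    Integrable (fun x => Real.exp (gibbsExponent u lam ν x)) (ν.prod μ) := by
  refine (lintegral_ofReal_ne_top_iff_integrable
    (measurable_gibbsExponent hu lam ν).exp.aestronglyMeasurable
    (ae_of_all _ fun x => Real.exp_nonneg _)).1 ?_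
  rw [lintegral_exp_gibbsExponent hu hubar hlam]
  exact ENNReal.one_ne_top

theorem integral_exp_gibbsExponent (hu : Measurable u) (hubar : ∀ x, u x ≤ ubar)
    (hlam : 0 < lam) :
    ∫ x, Real.exp (gibbsExponent u lam ν x) ∂(ν.prod μ) = 1 := by
  rw [integral_eq_lintegral_of_nonneg_ae (ae_of_all _ fun x => Real.exp_nonneg _)
    (measurable_gibbsExponent hu lam ν).exp.aestronglyMeasurable,
    lintegral_exp_gibbsExponent hu hubar hlam, ENNReal.toReal_one]

/-- By Fubini, almost every section of the integrable Gibbs density is integrable; optimality of `ν`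
plays no role. -/
theorem ae_integrable_exp_div_partition (hu : Measurable u) (hubar : ∀ x, u x ≤ ubar)
    (hlam : 0 < lam) :
    ∀ᵐ α ∂ν, Integrable (fun ω => Real.exp (u (α, ω) / lam) / partition u lam ν ω) μ := by
  filter_upwards [(integrable_exp_gibbsExponent (μ := μ) (ν := ν) hu hubar hlam).prod_right_ae]
    with α hα
  simpa only [exp_gibbsExponent hu hubar hlam] using hα

theorem gibbsPolicy_eq_withDensity (hu : Measurable u) (hubar : ∀ x, u x ≤ ubar)
    (hlam : 0 < lam) :
    gibbsPolicy u lam μ ν = (ν.prod μ).withDensity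
      fun x => ENNReal.ofReal (Real.exp (gibbsExponent u lam ν x)) := by
  rw [gibbsPolicy, Measure.tilted, integral_exp_gibbsExponent hu hubar hlam]
  simp

theorem isProbabilityMeasure_gibbsPolicy (hu : Measurable u) (hubar : ∀ x, u x ≤ ubar)
    (hlam : 0 < lam) : IsProbabilityMeasure (gibbsPolicy u lam μ ν) :=
  isProbabilityMeasure_tilted (integrable_exp_gibbsExponent hu hubar hlam)

theorem snd_gibbsPolicy (hu : Measurable u) (hubar : ∀ x, u x ≤ ubar) (hlam : 0 < lam) :
    (gibbsPolicy u lam μ ν).snd = μ := by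
  ext s hs
  rw [Measure.snd_apply hs, gibbsPolicy_eq_withDensity hu hubar hlam,
    withDensity_apply _ (measurable_snd hs), setLIntegral_exp_gibbsExponent hu hubar hlam hs]

theorem rnDeriv_gibbsPolicy (hu : Measurable u) (hubar : ∀ x, u x ≤ ubar) (hlam : 0 < lam) :
    (gibbsPolicy u lam μ ν).rnDeriv (ν.prod μ) =ᵐ[ν.prod μ]
      fun x => ENNReal.ofReal (Real.exp (gibbsExponent u lam ν x)) := by
  rw [gibbsPolicy_eq_withDensity hu hubar hlam]
  exact Measure.rnDeriv_withDensity _ (measurable_gibbsExponent hu lam ν).exp.ennreal_ofReal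

theorem coe_sub_klDiv {X : Type*} [MeasurableSpace X] {P ρ : Measure X} (h : klDiv P ρ ≠ ⊤)
    (c : ℝ) : (c : EReal) - (klDiv P ρ : EReal) = ((c - (klDiv P ρ).toReal : ℝ) : EReal) := by
  rw [EReal.coe_sub, EReal.coe_ennreal_toReal h]

/-- A coupling of finite payoff has a payoff which falls short of the Jensen envelope by its
divergence from the Gibbs policy. -/
theorem bridgePayoff_eq_sub_klDiv_gibbsPolicy (hu : Measurable u) (hubar : ∀ x, u x ≤ ubar)
    (hlam : 0 < lam) {P : Measure (A × Ω)} (hP : P ∈ couplings ν μ)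
    (hne : bridgePayoff u lam ν μ P ≠ ⊥) :
    Integrable (fun ω => Real.log (partition u lam ν ω)) μ ∧
      klDiv P (gibbsPolicy u lam μ ν) ≠ ⊤ ∧
      bridgePayoff u lam ν μ P = ((∫ ω, Real.log (partition u lam ν ω) ∂μ
        - (klDiv P (gibbsPolicy u lam μ ν)).toReal : ℝ) : EReal) := by
  obtain ⟨hPp, -, hPs⟩ := hP
  have hkl : klDiv P (ν.prod μ) ≠ ⊤ := fun h => hne (by
    rw [bridgePayoff, h, EReal.coe_ennreal_top, EReal.sub_top])
  obtain ⟨hac, hllr⟩ := klDiv_ne_top_iff.1 hkl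
  have hui : Integrable (fun x => u x / lam) P := by
    refine (extIntegral_eq_bot_or_integrable (hu.div_const lam).aestronglyMeasurable
      (C := ubar / lam) fun x => div_le_div_of_nonneg_right (hubar x) hlam.le).resolve_left ?_
    intro h
    exact hne (by rw [bridgePayoff, h, EReal.bot_sub])
  have hexp := integrable_exp_gibbsExponent (μ := μ) (ν := ν) hu hubar hlam
  have hlogm := (measurable_partition hu lam ν).log
  -- With `t = u / lam - log Z - llr`, the inequality `t + 1 ≤ exp t` bounds `log Z` below by an
  -- integrable function. Thus a coupling of finite payoff forces `f(ν)` to be finite.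
  have hlogP : Integrable (fun x : A × Ω => Real.log (partition u lam ν x.2)) P := by
    refine integrable_of_le_of_le (hlogm.comp measurable_snd).aestronglyMeasurable
      (g₁ := fun x => u x / lam - llr P (ν.prod μ) x
        - Real.exp (gibbsExponent u lam ν x - llr P (ν.prod μ) x))
      (g₂ := fun _ => ubar / lam) (ae_of_all _ fun x => ?_)
      (ae_of_all _ fun x => log_partition_le hu hubar hlam ν x.2)
      ((hui.sub hllr).sub
        (integrable_exp_sub_llr hac (measurable_gibbsExponent hu lam ν) hexp))
      (integrable_const _)
    have := Real.add_one_le_exp (gibbsExponent u lam ν x - llr P (ν.prod μ) x)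
    simp only [gibbsExponent] at this ⊢
    linarith
  have hlog := (integrable_comp_snd_iff hPs hlogm).1 hlogP
  obtain ⟨h1, h2⟩ := toReal_klDiv_tilted hkl (g := gibbsExponent u lam ν) (hui.sub hlogP) hexp
    (integral_exp_gibbsExponent hu hubar hlam)
  refine ⟨hlog, h1, ?_⟩
  have h3 : ∫ x, gibbsExponent u lam ν x ∂P
      = ∫ x, u x / lam ∂P - ∫ ω, Real.log (partition u lam ν ω) ∂μ := by
    rw [← integral_comp_snd hPs hlogm]
    exact integral_sub hui hlogP
  rw [gibbsPolicy, h2, h3, bridgePayoff, extIntegral_of_integrable hui, coe_sub_klDiv hkl]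
  congr 1
  ring

theorem bridgeValue_le_envelope (hu : Measurable u) (hubar : ∀ x, u x ≤ ubar) (hlam : 0 < lam) :
    bridgeValue u lam μ ν ≤ envelope u lam μ ν := by
  refine iSup₂_le fun P hP => ?_
  by_cases hne : bridgePayoff u lam ν μ P = ⊥
  · rw [hne]; exact bot_le
  · obtain ⟨h1, -, h3⟩ := bridgePayoff_eq_sub_klDiv_gibbsPolicy hu hubar hlam hP hne
    rw [h3, envelope, extIntegral_of_integrable h1, EReal.coe_le_coe_iff]
    linarith [ENNReal.toReal_nonneg (a := klDiv P (gibbsPolicy u lam μ ν))]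

/-- With reference measure `ν ⊗ μ` the Gibbs policy earns exactly a finite `f(ν)`; passing to its
own first marginal can only raise the payoff. -/
theorem envelope_le_policyPayoff_gibbsPolicy [StandardBorelSpace Ω] (hu : Measurable u)
    (hubar : ∀ x, u x ≤ ubar) (hlam : 0 < lam) :
    envelope u lam μ ν ≤ policyPayoff u lam (gibbsPolicy u lam μ ν) := by
  by_cases hbot : envelope u lam μ ν = ⊥
  · rw [hbot]; exact bot_le
  have hlog := hbot
  rw [envelope_eq_bot_iff hu hubar hlam, not_not] at hlog
  have hlogm := (measurable_partition hu lam ν).log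
  have hexp := integrable_exp_gibbsExponent (μ := μ) (ν := ν) hu hubar hlam
  have hgm := measurable_gibbsExponent hu lam ν
  have hQs := snd_gibbsPolicy (μ := μ) (ν := ν) hu hubar hlam
  have := isProbabilityMeasure_gibbsPolicy (μ := μ) (ν := ν) hu hubar hlam
  have hlogQ := (integrable_comp_snd_iff hQs hlogm).2 hlog
  -- The lower bound is `g ≥ 1 - exp (-g)`, with `exp (-g)` integrable under the tilt; the upper
  -- bound uses `u ≤ ubar`.
  have hgQ : Integrable (gibbsExponent u lam ν) (gibbsPolicy u lam μ ν) := by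
    refine integrable_of_le_of_le hgm.aestronglyMeasurable
      (g₁ := fun x => -Real.exp (-gibbsExponent u lam ν x))
      (g₂ := fun x => ubar / lam - Real.log (partition u lam ν x.2))
      (ae_of_all _ fun x => ?_) (ae_of_all _ fun x => ?_)
      (integrable_exp_neg_tilted hexp).neg ((integrable_const _).sub hlogQ)
    · linarith [Real.add_one_le_exp (-gibbsExponent u lam ν x)]
    · exact sub_le_sub_right (div_le_div_of_nonneg_right (hubar x) hlam.le) _
  have hui : Integrable (fun x => u x / lam) (gibbsPolicy u lam μ ν) :=
    (hgQ.add hlogQ).congr (ae_of_all _ fun x => by simp [gibbsExponent])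
  obtain ⟨h1, h2⟩ := klDiv_tilted_self hgm hexp (integral_exp_gibbsExponent hu hubar hlam) hgQ
  change klDiv (gibbsPolicy u lam μ ν) (ν.prod μ) ≠ ⊤ at h1
  change (klDiv (gibbsPolicy u lam μ ν) (ν.prod μ)).toReal
    = ∫ x, gibbsExponent u lam ν x ∂(gibbsPolicy u lam μ ν) at h2
  have h3 : ∫ x, gibbsExponent u lam ν x ∂(gibbsPolicy u lam μ ν)
      = ∫ x, u x / lam ∂(gibbsPolicy u lam μ ν) - ∫ ω, Real.log (partition u lam ν ω) ∂μ := by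
    rw [← integral_comp_snd hQs hlogm]
    exact integral_sub hui hlogQ
  calc envelope u lam μ ν = extIntegral (gibbsPolicy u lam μ ν) (fun x => u x / lam)
        - (klDiv (gibbsPolicy u lam μ ν) (ν.prod μ) : EReal) := by
        rw [envelope, extIntegral_of_integrable hlog, extIntegral_of_integrable hui,
          coe_sub_klDiv h1, h2, h3]
        congr 1
        ring
    _ ≤ _ := by
        rw [policyPayoff, hQs]
        exact EReal.sub_le_sub le_rfl
          (EReal.coe_ennreal_le_coe_ennreal_iff.2 (klDiv_fst_prod_le _ ν μ))

/-- The Gibbs policy is the only coupling that attains a finite Jensen envelope. -/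
theorem eq_gibbsPolicy_of_bridgePayoff_eq (hu : Measurable u) (hubar : ∀ x, u x ≤ ubar)
    (hlam : 0 < lam) {P : Measure (A × Ω)} (hP : P ∈ couplings ν μ)
    (hpay : bridgePayoff u lam ν μ P = envelope u lam μ ν) (hne : envelope u lam μ ν ≠ ⊥) :
    P = gibbsPolicy u lam μ ν := by
  obtain ⟨h1, h2, h3⟩ := bridgePayoff_eq_sub_klDiv_gibbsPolicy hu hubar hlam hP (hpay ▸ hne)
  have := hP.1
  have := isProbabilityMeasure_gibbsPolicy (μ := μ) (ν := ν) hu hubar hlam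
  rw [hpay, envelope, extIntegral_of_integrable h1, EReal.coe_eq_coe_iff] at h3
  rw [← klDiv_eq_zero_iff]
  refine ((ENNReal.toReal_eq_zero_iff _).1 ?_).resolve_right h2
  linarith

theorem exists_const_of_exp_eq_gibbs {a : A → ℝ} {b : Ω → ℝ}
    (h : (fun x : A × Ω => ENNReal.ofReal (Real.exp (u x / lam - a x.1 - b x.2)))
      =ᵐ[ν.prod μ] fun x => ENNReal.ofReal (Real.exp (gibbsExponent u lam ν x))) :
    ∃ c : ℝ, (∀ᵐ α ∂ν, a α = c) ∧
      ∀ᵐ ω ∂μ, b ω = Real.log (partition u lam ν ω) - c := by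
  have h1 : ∀ᵐ x ∂(ν.prod μ), a x.1 + b x.2 = Real.log (partition u lam ν x.2) := by
    filter_upwards [h] with x hx
    rw [ENNReal.ofReal_eq_ofReal_iff (Real.exp_nonneg _) (Real.exp_nonneg _),
      Real.exp_eq_exp, gibbsExponent] at hx
    linarith
  have h2 := Measure.ae_ae_of_ae_prod h1
  obtain ⟨α₀, hα₀⟩ := h2.exists
  refine ⟨a α₀, ?_, ?_⟩
  · filter_upwards [h2] with α hα
    -- Both `α` and `α₀` satisfy `a + b ω = log Z(ω)` at a common `ω`, so `a α = a α₀`.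
    obtain ⟨ω, hω, hω'⟩ := (hα.and hα₀).exists
    linarith
  · filter_upwards [hα₀] with ω hω
    linarith

end Gibbs

end RationalInattention

/-! ### The main theorem -/

theorem mainTheorem6 {A Ω : Type*}
    [TopologicalSpace A] [PolishSpace A] [MeasurableSpace A] [BorelSpace A]
    [TopologicalSpace Ω] [PolishSpace Ω] [MeasurableSpace Ω] [BorelSpace Ω]
    (μ : Measure Ω) [IsProbabilityMeasure μ]
    (u : A × Ω → ℝ) (hu : Measurable u) (ubar : ℝ) (hubar : ∀ x, u x ≤ ubar)
    (lam : ℝ) (hlam : 0 < lam) :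
    (∀ ν ψ : Measure A, IsProbabilityMeasure ν → IsProbabilityMeasure ψ →
      -- the difference quotients are not of the form `(-∞) - (-∞)`
      (∀ᶠ ε : ℝ in 𝓝[>] 0,
        ¬ (RationalInattention.envelope u lam μ (RationalInattention.mixture ν ψ ε) = ⊥ ∧
            RationalInattention.envelope u lam μ ν = ⊥)) →
      RationalInattention.HasGateauxDeriv (RationalInattention.envelope u lam μ) ν ψ
        (RationalInattention.extIntegral μ (fun ω =>
          (∫ α, Real.exp (u (α, ω) / lam) ∂ψ) / (∫ α, Real.exp (u (α, ω) / lam) ∂ν) - 1))) ∧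
    (∀ (P : Measure (A × Ω)) (ν : Measure A),
      RationalInattention.IsOptimalPolicy u lam μ P → P.fst = ν →
      RationalInattention.bridgeValue u lam μ ν = RationalInattention.envelope u lam μ ν ∧
      (∀ᵐ α ∂ν, Integrable
        (fun ω => Real.exp (u (α, ω) / lam) / RationalInattention.partition u lam ν ω) μ) ∧
      (RationalInattention.policyPayoff u lam P ≠ ⊥ →
        RationalInattention.IsSchrodingerPotentials u lam ν μ P (fun _ => 0)
          (fun ω => Real.log (RationalInattention.partition u lam ν ω)) ∧
        (∀ (Q : Measure (A × Ω)) (a : A → ℝ) (b : Ω → ℝ),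
          RationalInattention.IsSchrodingerPotentials u lam ν μ Q a b →
          ∃ c : ℝ, (∀ᵐ α ∂ν, a α = c) ∧
            (∀ᵐ ω ∂μ, b ω = Real.log (RationalInattention.partition u lam ν ω) - c)) ∧
        RationalInattention.envelope u lam μ ν =
          ((∫ ω, Real.log (RationalInattention.partition u lam ν ω) ∂μ : ℝ) : EReal))) := by
  refine ⟨fun ν ψ _ _ hne =>
    RationalInattention.hasGateauxDeriv_envelope hu hubar hlam μ ν ψ hne, ?_⟩
  rintro P ν ⟨⟨hPp, hPs⟩, hopt⟩ rfl
  have hPc : P ∈ RationalInattention.couplings P.fst μ := ⟨hPp, rfl, hPs⟩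
  have hpay : RationalInattention.policyPayoff u lam P
      = RationalInattention.bridgePayoff u lam P.fst μ P := by
    rw [RationalInattention.policyPayoff, RationalInattention.bridgePayoff, hPs]
  have hVf := RationalInattention.bridgeValue_le_envelope (μ := μ) (ν := P.fst) hu hubar hlam
  have hfJ := (RationalInattention.envelope_le_policyPayoff_gibbsPolicy (μ := μ) (ν := P.fst)
    hu hubar hlam).trans (hopt _
      (RationalInattention.isProbabilityMeasure_gibbsPolicy hu hubar hlam)
      (RationalInattention.snd_gibbsPolicy hu hubar hlam))
  have hJV : RationalInattention.policyPayoff u lam P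
      ≤ RationalInattention.bridgeValue u lam μ P.fst := by
    rw [hpay]
    exact le_iSup₂_of_le P hPc le_rfl
  -- The chain `V(ν) ≤ f(ν) ≤ J(P) ≤ V(ν)` closes up.
  have hV := le_antisymm hVf (hfJ.trans hJV)
  have hJ := le_antisymm (hJV.trans hVf) hfJ
  refine ⟨hV, RationalInattention.ae_integrable_exp_div_partition hu hubar hlam, fun hbot => ?_⟩
  have hfbot := hJ ▸ hbot
  have hlog := hfbot
  rw [Ne, RationalInattention.envelope_eq_bot_iff hu hubar hlam, not_not] at hlog
  have hPQ := RationalInattention.eq_gibbsPolicy_of_bridgePayoff_eq hu hubar hlam hPc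
    (hpay ▸ hJ) hfbot
  have hder := RationalInattention.rnDeriv_gibbsPolicy (μ := μ) (ν := P.fst) hu hubar hlam
  refine ⟨⟨⟨hPc, by rw [← hpay, hJ, hV]⟩, integrable_const 0, hlog, ?_, ?_⟩, ?_,
    RationalInattention.extIntegral_of_integrable hlog⟩
  · have hac := tilted_absolutelyContinuous (P.fst.prod μ)
      (RationalInattention.gibbsExponent u lam P.fst)
    exact hPQ.le.absolutelyContinuous.trans hac
  · rw [← hPQ] at hder
    filter_upwards [hder] with x hx
    rw [hx, RationalInattention.gibbsExponent, sub_zero]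
  · rintro Q a b ⟨⟨hQc, hQ⟩, -, -, -, hQd⟩
    -- Any bridge `Q` attains `V(ν) = f(ν)`, so it is the Gibbs policy too, and its two density
    -- formulas can be compared.
    have hQP := RationalInattention.eq_gibbsPolicy_of_bridgePayoff_eq hu hubar hlam hQc
      (hQ.trans hV) hfbot
    rw [hQP] at hQd
    exact RationalInattention.exists_const_of_exp_eq_gibbs (hQd.symm.trans hder)
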